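/- All graphs are finite and simple, with at least one vertex. For a graph $G$ and an Abelian group $\mathcal{G}$, an edge labeling $f:E(G)\to\mathcal{G}$ is called $\mathcal{G}$-irregular if the weighted degrees $w(v)=\sum_{u\in N(v)}f(uv)$, $v\in V(G)$, are pairwise distinct. The group irregularity strength $s_g(G)$ is the smallest positive integer $s$ such that for every Abelian group $\mathcal{G}$ of order $s$ there exists a $\mathcal{G}$-irregular labeling of $G$. The lexicographic product $G\circ F$ has vertex set $V(G)\times V(F)$, with $(u,v)$ and $(x,y)$ adjacent if and only if either $ux\in E(G)$, or $u=x$ and $vy\in E(F)$. Let $\overline{K}_m$ denote the graph with $m$ vertices and no edges. Let $H$ be a graph of order $n$ with no isolated vertices, and let $G\cong H\circ\overline{K}_{2r}$ for some integer $r\ge 2$. Then $s_g(G)=2rn$ if $rn$ is even, and $s_g(G)=2rn+1$ if $rn$ is odd. -/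

import Mathlib

namespace GroupIrregularity

/-- The lexicographic product `G ∘ H`: `(u, v)` and `(x, y)` are adjacent iff `u` is adjacent to `x`
in `G`, or `u = x` and `v` is adjacent to `y` in `H`. -/
def lexProd {V W : Type*} (G : SimpleGraph V) (H : SimpleGraph W) : SimpleGraph (V × W) where
  Adj p q := G.Adj p.1 q.1 ∨ (p.1 = q.1 ∧ H.Adj p.2 q.2)
  symm := ⟨fun _ _ h => h.imp (fun h => h.symm) (fun h => ⟨h.1.symm, h.2.symm⟩)⟩
  loopless := ⟨fun _ h => h.elim (fun h => h.ne rfl) (fun h => h.2.ne rfl)⟩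

open Classical in
/-- The weighted degree `w(v) = ∑_{u ∈ N(v)} f(uv)` of a vertex under an edge labeling with values
in an Abelian group. -/
noncomputable def weightedDegree {V A : Type*} [Fintype V] [AddCommGroup A] (G : SimpleGraph V)
    (f : G.edgeSet → A) (v : V) : A :=
  ∑ u : G.neighborSet v, f ⟨s(v, u.1), G.mem_edgeSet.2 u.2⟩

/-- An edge labeling is irregular if the weighted degrees of all vertices are distinct. -/
def IsIrregularLabeling {V A : Type*} [Fintype V] [AddCommGroup A] (G : SimpleGraph V)
    (f : G.edgeSet → A) : Prop :=
  Function.Injective (weightedDegree G f)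

/-- `s` is a positive integer, and every Abelian group of order `s` admits an irregular labeling
of `G`. Positivity matters: there is no group of order `0` (and `Nat.card` of an infinite type
is `0`). Every finite group is isomorphic to one in `Type`, so the universe is no restriction. -/
def AllGroupsIrregular {V : Type*} [Fintype V] (G : SimpleGraph V) (s : ℕ) : Prop :=
  0 < s ∧ ∀ (A : Type) [AddCommGroup A], Nat.card A = s →
    ∃ f : G.edgeSet → A, IsIrregularLabeling G f

/-- The group irregularity strength `s_g(G)`: the smallest positive integer `s` such that every
Abelian group of order `s` admits an irregular labeling of `G`. The value is `0` exactly when there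
is no such `s`. -/
noncomputable def groupIrregularityStrength {V : Type*} [Fintype V] (G : SimpleGraph V) : ℕ :=
  sInf {s : ℕ | AllGroupsIrregular G s}

end GroupIrregularity

/-! Write `n` for the order of `H`. The `2rn` vertices need distinct weights, so the strength is at
least `2rn`. If `rn` is odd, the cyclic group of order `2rn` fails: every element would be a weight,
yet the weights sum to zero modulo two because each edge counts twice, while the sum of all elements
is odd.

For existence, labels `a`, `-a` on a path of length two move weight within a class of the blow-up,
so any weighting with zero class sums is realizable; one further edge allows a common sum `y` on two
adjacent classes. It remains to choose `n` disjoint `2r`-subsets of the group with such sums.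

In odd order, drop 0 and use pairs `{x, -x}`. In order `2rn` with `rn` even, pairs handle all but
the elements with `2x = 0`. With several involutions, those split into zero-sum cosets of a Klein
four-group. With a single involution `e`, divisibility by four gives `e = 2y`, and `{0, y}`, `{e,
-y}` both sum to `y`. -/

namespace GroupIrregularity

open Finset

/-! ### Weighted degrees and the parity obstruction -/

section Labelings

variable {V A : Type*} [Fintype V] [AddCommGroup A]

open Classical in
theorem weightedDegree_eq_sum_dite (G : SimpleGraph V) (f : G.edgeSet → A) (v : V) :
    weightedDegree G f v = ∑ u, if h : G.Adj v u then f ⟨s(v, u), h⟩ else 0 := by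
  unfold weightedDegree
  rw [Finset.sum_dite, Finset.sum_const_zero, add_zero]
  refine Finset.sum_bij' (fun u _ => ⟨u.1, mem_filter.2 ⟨mem_univ _, u.2⟩⟩)
    (fun u _ => ⟨u.1, (mem_filter.1 u.2).2⟩) ?_ ?_ ?_ ?_ ?_ <;> simp

/-- The vertex weightings that arise as weighted degrees of an edge labeling. -/
noncomputable def realizableWeights (G : SimpleGraph V) (A : Type*) [AddCommGroup A] :
    AddSubgroup (V → A) where
  carrier := Set.range (weightedDegree G)
  zero_mem' := ⟨0, by ext v; simp [weightedDegree]⟩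
  add_mem' := by
    rintro _ _ ⟨f, rfl⟩ ⟨g, rfl⟩
    exact ⟨f + g, by ext v; simp [weightedDegree, Finset.sum_add_distrib]⟩
  neg_mem' := by
    rintro _ ⟨f, rfl⟩
    exact ⟨-f, by ext v; simp [weightedDegree]⟩

theorem mem_realizableWeights {G : SimpleGraph V} {w : V → A} :
    w ∈ realizableWeights G A ↔ ∃ f, weightedDegree G f = w := Iff.rfl

theorem single_add_single_mem_realizableWeights [DecidableEq V] {G : SimpleGraph V} {p q : V}
    (h : G.Adj p q) (a : A) : Pi.single p a + Pi.single q a ∈ realizableWeights G A := by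
  classical
  refine ⟨fun e => if e.1 = s(p, q) then a else 0, ?_⟩
  ext v
  rw [weightedDegree_eq_sum_dite]
  have hpq := h.ne
  by_cases hvp : v = p
  · subst hvp
    rw [Finset.sum_eq_single q]
    · simp [h, hpq]
    · intro u _ hu
      simp [hu, hpq]
    · simp
  by_cases hvq : v = q
  · subst hvq
    rw [Finset.sum_eq_single p]
    · simp [h.symm, hpq, Sym2.eq_swap]
    · intro u _ hu
      simp [hu, hpq.symm]
    · simp
  · rw [Finset.sum_eq_zero]
    · simp [hvp, hvq]
    · intro u _
      simp [hvp, hvq]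

open Classical in
/-- Modulo two, the weighted degrees of an edge labeling sum to zero. -/
theorem sum_map_weightedDegree_eq_zero {B : Type*} [AddCommGroup B] (hB : ∀ b : B, b + b = 0)
    (φ : A →+ B) (G : SimpleGraph V) (f : G.edgeSet → A) :
    ∑ v, φ (weightedDegree G f v) = 0 := by
  simp_rw [weightedDegree_eq_sum_dite, map_sum]
  rw [← Finset.sum_product']
  -- Each edge is seen from both ends, and its two equal terms cancel in `B`.
  refine Finset.sum_involution (fun p _ => p.swap) ?_ ?_ ?_ ?_
  · rintro ⟨v, u⟩ -
    by_cases h : G.Adj v u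
    · have h' := h.symm
      simp only [Prod.swap, h, h', dite_true]
      rw [show (⟨s(u, v), h'⟩ : G.edgeSet) = ⟨s(v, u), h⟩ from Subtype.ext Sym2.eq_swap]
      exact hB _
    · have h' : ¬ G.Adj u v := fun h' => h h'.symm
      simp [h, h']
  · rintro ⟨v, u⟩ - hne heq
    obtain rfl : u = v := congrArg Prod.fst heq
    simp at hne
  · simp
  · simp

theorem AllGroupsIrregular.of_iso {W : Type*} [Fintype W] {G : SimpleGraph V}
    {G' : SimpleGraph W} (e : G ≃g G') {s : ℕ} (h : AllGroupsIrregular G' s) :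
    AllGroupsIrregular G s := by
  classical
  refine ⟨h.1, fun A _ hA => ?_⟩
  obtain ⟨f, hf⟩ := h.2 A hA
  refine ⟨fun x => f (e.mapEdgeSet x), fun v v' hv => e.injective (hf ?_)⟩
  have key : ∀ v, weightedDegree G (fun x => f (e.mapEdgeSet x)) v = weightedDegree G' f (e v) := by
    intro v
    simp_rw [weightedDegree_eq_sum_dite]
    refine Fintype.sum_equiv e.toEquiv _ _ fun u => ?_
    have : G'.Adj (e v) (e u) ↔ G.Adj v u := e.map_adj_iff
    by_cases hu : G.Adj v u
    · have hu' := this.2 hu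
      simp only [hu, dite_true, RelIso.coe_fn_toEquiv, hu']
      rfl
    · have hu' : ¬ G'.Adj (e v) (e u) := fun h => hu (this.1 h)
      rw [dif_neg hu]
      symm
      exact dif_neg hu'
  rw [← key, ← key, hv]

theorem AllGroupsIrregular.card_le {G : SimpleGraph V} {s : ℕ} (h : AllGroupsIrregular G s) :
    Fintype.card V ≤ s := by
  have : NeZero s := ⟨h.1.ne'⟩
  obtain ⟨f, hf⟩ := h.2 (ZMod s) (by simp)
  simpa using Fintype.card_le_of_injective _ hf

theorem sum_zmod_natCast_val (m : ℕ) [NeZero m] (R : Type*) [AddCommMonoidWithOne R] :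
    ∑ x : ZMod m, ((x.val : ℕ) : R) = ((∑ i ∈ range m, i : ℕ) : R) := by
  rw [Nat.cast_sum]
  refine Finset.sum_bij' (fun x _ => x.val) (fun i _ => (i : ZMod m)) ?_ ?_ ?_ ?_ ?_
  · intro x _; simpa using ZMod.val_lt x
  · simp
  · simp
  · intro i hi; exact ZMod.val_cast_of_lt (by simpa using hi)
  · simp

/-- No graph of order `m ≡ 2 (mod 4)` has an irregular labeling in the cyclic group of order `m`. -/
theorem not_allGroupsIrregular_two_mul_odd {G : SimpleGraph V} {k : ℕ} (hk : Odd k)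
    (hV : Fintype.card V = 2 * k) : ¬ AllGroupsIrregular G (2 * k) := by
  intro h
  have : NeZero (2 * k) := ⟨h.1.ne'⟩
  obtain ⟨f, hf⟩ := h.2 (ZMod (2 * k)) (by simp)
  -- By counting, every group element is a weight exactly once.
  have hbij : Function.Bijective (weightedDegree G f) :=
    (Fintype.bijective_iff_injective_and_card _).2 ⟨hf, by simp [hV]⟩
  have h0 := sum_map_weightedDegree_eq_zero (B := ZMod 2) (by decide)
    (ZMod.castHom (Dvd.intro k rfl) (ZMod 2)).toAddMonoidHom G f
  rw [hbij.sum_comp (fun x => (ZMod.castHom (Dvd.intro k rfl) (ZMod 2)).toAddMonoidHom x)] at h0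
  have h1 : ∑ x : ZMod (2 * k), ((x.val : ℕ) : ZMod 2) = 0 := by
    rw [← h0]
    refine Finset.sum_congr rfl fun x _ => ?_
    simp [ZMod.natCast_val]
  rw [sum_zmod_natCast_val, ZMod.natCast_eq_zero_iff] at h1
  have h2 := Finset.sum_range_id_mul_two (2 * k)
  have h3 : ∑ i ∈ range (2 * k), i = k * (2 * k - 1) := by
    have : (∑ i ∈ range (2 * k), i) * 2 = (k * (2 * k - 1)) * 2 := by rw [h2]; ring
    exact Nat.eq_of_mul_eq_mul_right two_pos this
  rw [h3] at h1
  have hpos := h.1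
  have : Odd (k * (2 * k - 1)) := hk.mul ⟨k - 1, by omega⟩
  exact (Nat.not_even_iff_odd.2 this) (even_iff_two_dvd.2 h1)

end Labelings

/-! ### Realizable weightings of the blow-up -/

section Rows

variable {V A : Type*} [Fintype V] [DecidableEq V] [AddCommGroup A]

/-- In the blow-up of a graph without isolated vertices, a weighting is realizable as soon as it
sums to zero over each class of the blow-up. -/
theorem mem_realizableWeights_of_sum_eq_zero {H : SimpleGraph V} (hH : ∀ v, ¬ H.IsIsolated v)
    {m : ℕ} {w : V × Fin m → A} (hw : ∀ u, ∑ i, w (u, i) = 0) :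
    w ∈ realizableWeights (lexProd H (⊥ : SimpleGraph (Fin m))) A := by
  -- Edges labelled `a` and `-a` meet at `(v, i)`, where their contributions cancel.
  have hdiff : ∀ u i j (a : A), Pi.single (u, i) a - Pi.single (u, j) a ∈
      realizableWeights (lexProd H (⊥ : SimpleGraph (Fin m))) A := by
    intro u i j a
    obtain ⟨v, hv⟩ : ∃ v, H.Adj u v := by simpa [SimpleGraph.IsIsolated] using hH u
    have h := sub_mem
      (single_add_single_mem_realizableWeights (G := lexProd H (⊥ : SimpleGraph (Fin m)))
        (p := (u, i)) (q := (v, i)) (Or.inl hv) a)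
      (single_add_single_mem_realizableWeights (G := lexProd H (⊥ : SimpleGraph (Fin m)))
        (p := (u, j)) (q := (v, i)) (Or.inl hv) a)
    simpa using h
  rcases Nat.eq_zero_or_pos m with rfl | hm
  · rw [Subsingleton.elim w 0]
    exact zero_mem _
  -- Balance every entry against index 0 of its class; the total subtracted there is the class sum,
  -- zero.
  · have hsum : w = ∑ u, ∑ i, (Pi.single (u, i) (w (u, i)) - Pi.single (u, ⟨0, hm⟩) (w (u, i))) := by
      simp_rw [Finset.sum_sub_distrib]
      have h0 : ∀ u, ∑ i, (Pi.single (u, (⟨0, hm⟩ : Fin m)) (w (u, i)) : V × Fin m → A) = 0 := by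
        intro u
        have := map_sum (AddMonoidHom.single (fun _ : V × Fin m => A) (u, (⟨0, hm⟩ : Fin m)))
          (fun i => w (u, i)) univ
        rw [hw, map_zero] at this
        exact this.symm
      simp_rw [h0, sum_const_zero, sub_zero]
      rw [← Fintype.sum_prod_type', Finset.univ_sum_single]
    rw [hsum]
    exact sum_mem fun u _ => sum_mem fun i _ => hdiff _ _ _ _

theorem mem_realizableWeights_of_sum_eq_single {H : SimpleGraph V} (hH : ∀ v, ¬ H.IsIsolated v)
    {m : ℕ} (hm : 0 < m) {w : V × Fin m → A} {p q : V} (hpq : H.Adj p q) (a : A)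
    (hw : ∀ u, ∑ i, w (u, i) = if u = p ∨ u = q then a else 0) :
    w ∈ realizableWeights (lexProd H (⊥ : SimpleGraph (Fin m))) A := by
  set x : V × Fin m → A := Pi.single (p, ⟨0, hm⟩) a + Pi.single (q, ⟨0, hm⟩) a with hx
  have hxm : x ∈ realizableWeights (lexProd H (⊥ : SimpleGraph (Fin m))) A :=
    single_add_single_mem_realizableWeights (Or.inl hpq) a
  rw [← sub_add_cancel w x]
  refine add_mem (mem_realizableWeights_of_sum_eq_zero hH fun u => ?_) hxm
  have hne := hpq.ne
  have hs : ∀ z, ∑ i, (Pi.single (z, (⟨0, hm⟩ : Fin m)) a : V × Fin m → A) (u, i) =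
      if u = z then a else 0 := by
    intro z
    rw [Finset.sum_eq_single ⟨0, hm⟩]
    · simp [Pi.single_apply]
    · intro i _ hi
      simp [hi]
    · simp
  simp only [Pi.sub_apply, Finset.sum_sub_distrib, hw, hx, Pi.add_apply, Finset.sum_add_distrib, hs]
  by_cases h1 : u = p
  · subst h1; simp [hne]
  · simp [h1]

/-- A coloring whose classes on `S` all have `m` elements yields an injective array. -/
theorem exists_injective_array {V A : Type*} [DecidableEq V] [AddCommMonoid A] {m : ℕ}
    {S : Finset A} {g : A → V}
    (hg : ∀ u, #{x ∈ S | g x = u} = m) :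
    ∃ w : V × Fin m → A, Function.Injective w ∧
      ∀ u, ∑ i, w (u, i) = ∑ x ∈ S with g x = u, x := by
  have e : ∀ u, Fin m ≃ {x // x ∈ S.filter (g · = u)} := fun u =>
    (Finset.equivFinOfCardEq (hg u)).symm
  refine ⟨fun p => (e p.1 p.2 : A), ?_, fun u => ?_⟩
  · rintro ⟨u, i⟩ ⟨v, j⟩ h
    have hu := (mem_filter.1 (e u i).2).2
    have hv := (mem_filter.1 (e v j).2).2
    simp only at h
    obtain rfl : u = v := by rw [← hu, ← hv, h]
    rw [(e u).injective (Subtype.ext h)]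
  · rw [← Finset.sum_coe_sort _ fun x : A => x]
    exact Fintype.sum_equiv (e u) _ _ fun i => rfl

end Rows

/-! ### Distributing zero-sum blocks -/

section Blocks

variable {A V : Type*} [AddCommGroup A] [DecidableEq A] [Fintype V] [DecidableEq V] [Nonempty V]

/-- If `S` is partitioned by `π` into zero-sum blocks of size `d`, the blocks can be distributed
among the elements of `V` with prescribed multiplicities. -/
theorem exists_block_coloring {S : Finset A} {π : A → Finset A} {d : ℕ}
    (hself : ∀ x ∈ S, x ∈ π x) (hsub : ∀ x ∈ S, π x ⊆ S) (heq : ∀ x ∈ S, ∀ y ∈ π x, π y = π x)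
    (hcard : ∀ x ∈ S, #(π x) = d) (hsum : ∀ x ∈ S, ∑ y ∈ π x, y = 0) :
    ∃ b, #S = d * b ∧ ∀ k : V → ℕ, ∑ u, k u = b →
      ∃ g : A → V, ∀ u, #{x ∈ S | g x = u} = d * k u ∧ ∑ x ∈ S with g x = u, x = 0 := by
  have hfib : ∀ x ∈ S, {y ∈ S | π y = π x} = π x := by
    intro x hx
    ext y
    rw [mem_filter]
    exact ⟨fun h => h.2 ▸ hself y h.1, fun h => ⟨hsub x hx h, heq x hx y h⟩⟩
  have hS : #S = d * #(S.image π) := by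
    rw [Finset.card_eq_sum_card_image π S, Finset.sum_const_nat (m := d), mul_comm]
    intro b hb
    obtain ⟨x, hx, rfl⟩ := mem_image.1 hb
    rw [hfib x hx, hcard x hx]
  refine ⟨_, hS, fun k hI => ?_⟩
  -- A bijection from blocks to slots, where `u` owns `k u` slots.
  have e : {b // b ∈ S.image π} ≃ Σ u, Fin (k u) := Fintype.equivOfCardEq (by simp [← hI])
  let v₀ : V := Classical.arbitrary V
  let c : Finset A → V := fun b => if h : b ∈ S.image π then (e ⟨b, h⟩).1 else v₀
  have hc : ∀ u, #{b ∈ S.image π | c b = u} = k u := by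
    intro u
    have : #{b ∈ S.image π | c b = u} = Fintype.card {p : Σ u, Fin (k u) // p.1 = u} := by
      rw [← Fintype.card_coe]
      refine Fintype.card_congr ?_
      refine ⟨fun b => ⟨e ⟨b.1, (mem_filter.1 b.2).1⟩, ?_⟩, fun p => ⟨(e.symm p.1).1, ?_⟩, ?_, ?_⟩
      · have := (mem_filter.1 b.2)
        simpa only [c, this.1, dite_true] using this.2
      · rw [mem_filter]
        refine ⟨(e.symm p.1).2, ?_⟩
        have := (e.symm p.1).2
        simp only [c, this, dite_true, Subtype.coe_eta, Equiv.apply_symm_apply, p.2]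
      · intro b; simp
      · intro p; simp
    rw [this, Fintype.card_congr (Equiv.sigmaSubtype u), Fintype.card_fin]
  refine ⟨fun x => c (π x), fun u => ?_⟩
  have hmaps : ∀ x ∈ ({x ∈ S | c (π x) = u} : Finset A), π x ∈ {b ∈ S.image π | c b = u} := by
    intro x hx
    rw [mem_filter] at hx ⊢
    exact ⟨mem_image_of_mem _ hx.1, hx.2⟩
  have hfib' : ∀ b ∈ ({b ∈ S.image π | c b = u} : Finset (Finset A)),
      ∃ x ∈ S, b = π x ∧ {y ∈ ({x ∈ S | c (π x) = u} : Finset A) | π y = b} = π x := by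
    intro b hb
    obtain ⟨hb, hbu⟩ := mem_filter.1 hb
    obtain ⟨x, hx, rfl⟩ := mem_image.1 hb
    refine ⟨x, hx, rfl, ?_⟩
    ext y
    rw [← hfib x hx, mem_filter, mem_filter, mem_filter, hfib x hx]
    constructor
    · tauto
    · rintro ⟨h1, h2⟩
      exact ⟨⟨h1, h2 ▸ hbu⟩, h2⟩
  constructor
  · rw [Finset.card_eq_sum_card_fiberwise hmaps, Finset.sum_const_nat (m := d), hc, mul_comm]
    intro b hb
    obtain ⟨x, hx, rfl, h⟩ := hfib' b hb
    rw [h, hcard x hx]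
  · rw [← Finset.sum_fiberwise_of_maps_to hmaps]
    refine Finset.sum_eq_zero fun b hb => ?_
    obtain ⟨x, hx, rfl, h⟩ := hfib' b hb
    rw [h, hsum x hx]

end Blocks

/-! ### Blocks from negation pairs and Klein cosets -/

section Colorings

variable {A V : Type*} [AddCommGroup A] [DecidableEq A] [Fintype V] [DecidableEq V] [Nonempty V]

theorem exists_neg_pair_coloring {S : Finset A} (hneg : ∀ x ∈ S, -x ∈ S)
    (hne : ∀ x ∈ S, x + x ≠ 0) {k : V → ℕ} (hk : 2 * ∑ u, k u = #S) :
    ∃ g : A → V, ∀ u, #{x ∈ S | g x = u} = 2 * k u ∧ ∑ x ∈ S with g x = u, x = 0 := by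
  have hne' : ∀ x ∈ S, x ≠ -x := fun x hx h => hne x hx (add_eq_zero_iff_eq_neg.2 h)
  obtain ⟨b, hb, hcol⟩ : ∃ b, #S = 2 * b ∧ ∀ k : V → ℕ, ∑ u, k u = b →
      ∃ g : A → V, ∀ u, #{x ∈ S | g x = u} = 2 * k u ∧ ∑ x ∈ S with g x = u, x = 0 := by
    refine exists_block_coloring (π := fun x => {x, -x}) ?_ ?_ ?_ ?_ ?_
    · simp
    · intro x hx y hy
      simp only [mem_insert, mem_singleton] at hy
      rcases hy with rfl | rfl
      exacts [hx, hneg _ hx]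
    · intro x hx y hy
      simp only [mem_insert, mem_singleton] at hy
      rcases hy with rfl | rfl
      · rfl
      · simp [pair_comm]
    · exact fun x hx => card_pair (hne' x hx)
    · intro x hx
      rw [sum_pair (hne' x hx), add_neg_cancel]
  exact hcol k (by omega)

theorem card_klein_coset {e f : A} (he : e ≠ 0) (hf : f ≠ 0) (hef : e + f ≠ 0) (hne : e ≠ f)
    (x : A) : #{x, x + e, x + f, x + (e + f)} = 4 := by
  rw [card_insert_of_notMem, card_insert_of_notMem, card_pair] <;> simp_all

/-- The blocks are cosets of `{0, e, f, e + f}`; each sums to `4x + 2e + 2f = 0`. -/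
theorem exists_klein_coset_coloring [Fintype A] {e f : A} (he : e ≠ 0) (hf : f ≠ 0) (hne : e ≠ f)
    (he2 : e + e = 0) (hf2 : f + f = 0) :
    ∃ b, #{x : A | x + x = 0} = 4 * b ∧ ∀ k : V → ℕ, ∑ u, k u = b →
      ∃ g : A → V, ∀ u, #{x ∈ ({x : A | x + x = 0} : Finset A) | g x = u} = 4 * k u ∧
        ∑ x ∈ ({x : A | x + x = 0} : Finset A) with g x = u, x = 0 := by
  have hef : e + f ≠ 0 := fun h =>
    hne ((add_eq_zero_iff_eq_neg.1 h).trans (add_eq_zero_iff_eq_neg.1 hf2).symm)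
  have hef2 : e + f + (e + f) = 0 := by rw [add_add_add_comm, he2, hf2, add_zero]
  have hcard := card_klein_coset he hf hef hne
  refine exists_block_coloring (π := fun x => {x, x + e, x + f, x + (e + f)}) ?_ ?_ ?_ ?_ ?_
  · simp
  · intro x hx y hy
    simp only [mem_insert, mem_singleton, mem_filter_univ] at hy hx ⊢
    rcases hy with rfl | rfl | rfl | rfl
    · exact hx
    · rw [add_add_add_comm, hx, he2, add_zero]
    · rw [add_add_add_comm, hx, hf2, add_zero]
    · rw [add_add_add_comm, hx, hef2, add_zero]
  · intro x hx y hy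
    simp only [mem_insert, mem_singleton] at hy
    have h1 : ∀ z : A, z + e + e = z := fun z => by rw [add_assoc, he2, add_zero]
    have h2 : ∀ z : A, z + f + f = z := fun z => by rw [add_assoc, hf2, add_zero]
    rcases hy with rfl | rfl | rfl | rfl
    · rfl
    · ext z
      have e1 : x + e + (e + f) = x + f := by rw [← add_assoc, h1]
      simp only [mem_insert, mem_singleton, h1, e1, ← add_assoc]
      tauto
    · ext z
      have e1 : x + f + e = x + e + f := by abel
      simp only [mem_insert, mem_singleton, e1, h2, ← add_assoc]
      tauto
    · ext z
      have e1 : x + e + f + e = x + f := by rw [add_right_comm, h1]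
      simp only [mem_insert, mem_singleton, ← add_assoc, h2, e1]
      tauto
  · exact fun x _ => hcard x
  · intro x hx
    have hx2 : x + x = 0 := by simpa using hx
    rw [sum_insert, sum_insert, sum_pair]
    · calc x + (x + e + (x + f + (x + (e + f))))
          = (x + x) + (x + x) + (e + e) + (f + f) := by abel
        _ = 0 := by simp only [hx2, he2, hf2, add_zero]
    all_goals simp_all


/-- Used to fix how many Klein cosets each class receives. -/
theorem exists_le_sum_eq {V : Type*} [Fintype V] [DecidableEq V] {b q : ℕ}
    (h : q ≤ Fintype.card V * b) :
    ∃ a : V → ℕ, (∀ u, a u ≤ b) ∧ ∑ u, a u = q := by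
  induction q with
  | zero => exact ⟨0, by simp, by simp⟩
  | succ q ih =>
    obtain ⟨a, ha, hq⟩ := ih (by omega)
    obtain ⟨u, hu⟩ : ∃ u, a u < b := by
      by_contra! hb
      have := Finset.card_nsmul_le_sum univ a b fun u _ => hb u
      rw [smul_eq_mul, hq, card_univ] at this
      omega
    refine ⟨a + Pi.single u 1, fun v => ?_, ?_⟩
    · by_cases hv : v = u
      · subst hv; simpa using hu
      · simpa [hv] using ha v
    · simp [Finset.sum_add_distrib, hq]

theorem exists_union_coloring {A V : Type*} [AddCommMonoid A] [DecidableEq A] [DecidableEq V]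
    {S T : Finset A} (hST : Disjoint S T) (g h : A → V) :
    ∃ c : A → V, ∀ u,
      #{x ∈ S ∪ T | c x = u} = #{x ∈ S | g x = u} + #{x ∈ T | h x = u} ∧
      ∑ x ∈ S ∪ T with c x = u, x = ∑ x ∈ S with g x = u, x + ∑ x ∈ T with h x = u, x := by
  refine ⟨fun x => if x ∈ S then g x else h x, fun u => ?_⟩
  have h1 : {x ∈ S | (if x ∈ S then g x else h x) = u} = {x ∈ S | g x = u} :=
    filter_congr fun x hx => by rw [if_pos hx]
  have h2 : {x ∈ T | (if x ∈ S then g x else h x) = u} = {x ∈ T | h x = u} :=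
    filter_congr fun x hx => by rw [if_neg (disjoint_right.1 hST hx)]
  have hd := disjoint_filter_filter (p := (g · = u)) (q := (h · = u)) hST
  rw [filter_union, h1, h2]
  exact ⟨card_union_of_disjoint hd, sum_union hd⟩

end Colorings

/-! ### Involutions and colorings of the whole group -/

section Groups

variable {A V : Type*} [AddCommGroup A] [Fintype A] [DecidableEq A] [Fintype V] [DecidableEq V]

theorem exists_ne_zero_add_self_eq_zero {A : Type*} [AddGroup A] [Fintype A]
    (h : 2 ∣ Fintype.card A) : ∃ e : A, e ≠ 0 ∧ e + e = 0 := by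
  obtain ⟨e, he⟩ := exists_prime_addOrderOf_dvd_card 2 h
  refine ⟨e, ?_, ?_⟩
  · rintro rfl; simp at he
  · rw [← two_nsmul, ← he, addOrderOf_nsmul_eq_zero]

theorem eq_zero_of_add_self_eq_zero {A : Type*} [AddGroup A] [Fintype A]
    (h : Odd (Fintype.card A)) {x : A} (hx : x + x = 0) :
    x = 0 := by
  have h1 : addOrderOf x ∣ 2 := addOrderOf_dvd_of_nsmul_eq_zero (by rw [two_nsmul, hx])
  have h2 : addOrderOf x ∣ Fintype.card A := addOrderOf_dvd_card
  have : addOrderOf x ∣ 1 := by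
    rw [← (Nat.coprime_two_left.2 h).gcd_eq_one]
    exact Nat.dvd_gcd h1 h2
  simpa using this

/-- If the order is divisible by four and there is only one involution, that involution is
divisible by two. -/
theorem exists_add_self_eq_of_unique_involution (h : 4 ∣ Fintype.card A) {e : A} (he : e ≠ 0)
    (he2 : e + e = 0) (huniq : ∀ x : A, x + x = 0 → x = 0 ∨ x = e) : ∃ y : A, y + y = e := by
  let φ : A →+ A := nsmulAddMonoidHom 2
  have hφ : ∀ x, φ x = x + x := fun x => two_nsmul x
  have hker : Nat.card φ.ker = 2 := by
    have : (φ.ker : Set A) = {0, e} := by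
      ext x
      simp only [SetLike.mem_coe, AddMonoidHom.mem_ker, hφ, Set.mem_insert_iff,
        Set.mem_singleton_iff]
      exact ⟨huniq x, by rintro (rfl | rfl) <;> simp [he2]⟩
    rw [← SetLike.coe_sort_coe, this, Nat.card_coe_set_eq, Set.ncard_pair he.symm]
  have hmul := φ.ker.card_mul_index
  rw [AddSubgroup.index_ker, hker, Nat.card_eq_fintype_card (α := A)] at hmul
  -- The image of doubling has order `|A| / 2`, which is even, so it contains an involution,
  -- necessarily `e`.
  have h2 : 2 ∣ Nat.card φ.range := by omega
  rw [Nat.card_eq_fintype_card] at h2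
  obtain ⟨⟨_, y, rfl⟩, hz, hz2⟩ := exists_ne_zero_add_self_eq_zero h2
  refine ⟨y, ?_⟩
  rw [← hφ]
  refine (huniq (φ y) (congrArg Subtype.val hz2)).resolve_left fun h => hz (Subtype.ext h)

/-- A translate of the 2-torsion by an element outside it is disjoint from it. -/
theorem two_mul_card_add_self_eq_zero_le (h : ∃ x : A, x + x ≠ 0) :
    2 * #{x : A | x + x = 0} ≤ Fintype.card A := by
  obtain ⟨a, ha⟩ := h
  have hinj : #(({x : A | x + x = 0} : Finset A).image (a + ·)) = #{x : A | x + x = 0} :=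
    card_image_of_injective _ (add_right_injective a)
  have hd : Disjoint ({x : A | x + x = 0} : Finset A)
      (({x : A | x + x = 0} : Finset A).image (a + ·)) := by
    rw [disjoint_right]
    intro z hz hz'
    obtain ⟨y, hy, rfl⟩ := mem_image.1 hz
    rw [mem_filter_univ] at hy hz'
    rw [add_add_add_comm, hy, add_zero] at hz'
    exact ha hz'
  calc 2 * #{x : A | x + x = 0} = #(({x : A | x + x = 0} : Finset A) ∪
        (({x : A | x + x = 0} : Finset A).image (a + ·))) := by
          rw [card_union_of_disjoint hd, hinj, two_mul]
    _ ≤ _ := card_le_univ _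

theorem exists_add_self_ne_zero_of_odd_dvd {A : Type*} [AddGroup A] [Fintype A] {r : ℕ} (hr : 2 ≤ r)
    (hodd : Odd r) (h : r ∣ Fintype.card A) : ∃ x : A, x + x ≠ 0 := by
  have hp := Nat.minFac_prime (show r ≠ 1 by omega)
  have := Fact.mk hp
  obtain ⟨x, hx⟩ := exists_prime_addOrderOf_dvd_card (G := A) r.minFac ((Nat.minFac_dvd r).trans h)
  refine ⟨x, fun h0 => ?_⟩
  have h1 : r.minFac ∣ 2 := hx ▸ addOrderOf_dvd_of_nsmul_eq_zero (by rw [two_nsmul, h0])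
  have h2 := (Nat.prime_dvd_prime_iff_eq hp Nat.prime_two).1 h1
  exact (Nat.not_even_iff_odd.2 hodd) (even_iff_two_dvd.2 (h2 ▸ Nat.minFac_dvd r))

variable [Nonempty V]

theorem exists_coloring_of_odd_card {r : ℕ} (hA : Fintype.card A = 2 * r * Fintype.card V + 1) :
    ∃ (S : Finset A) (g : A → V), ∀ u, #{x ∈ S | g x = u} = 2 * r ∧
      ∑ x ∈ S with g x = u, x = 0 := by
  have hodd : Odd (Fintype.card A) := ⟨r * Fintype.card V, by rw [hA]; ring⟩
  refine ⟨univ.erase 0, exists_neg_pair_coloring (k := fun _ => r) ?_ ?_ ?_⟩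
  · simp
  · intro x hx h
    exact (ne_of_mem_erase hx) (eq_zero_of_add_self_eq_zero hodd h)
  · rw [card_erase_of_mem (mem_univ _), card_univ, hA]
    simp
    ring

theorem exists_coloring_of_two_involutions {r : ℕ} (hr : 2 ≤ r)
    (hA : Fintype.card A = 2 * r * Fintype.card V) {e f : A} (he : e ≠ 0) (hf : f ≠ 0)
    (hne : e ≠ f) (he2 : e + e = 0) (hf2 : f + f = 0) :
    ∃ (S : Finset A) (g : A → V), ∀ u, #{x ∈ S | g x = u} = 2 * r ∧
      ∑ x ∈ S with g x = u, x = 0 := by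
  set T : Finset A := {x : A | x + x = 0} with hT
  obtain ⟨q, hq, hcol⟩ := exists_klein_coset_coloring (V := V) he hf hne he2 hf2
  rw [← hT] at hq hcol
  -- A class holds at most `r / 2` cosets of size four. For odd `r = 2s + 1` the rounding loses
  -- room, but an odd prime divides the order, so the 2-torsion is at most half the group; then `s ≥
  -- 1` suffices.
  have hqle : q ≤ Fintype.card V * (r / 2) := by
    rcases Nat.even_or_odd' r with ⟨s, rfl | rfl⟩
    · have : #T ≤ Fintype.card A := card_le_univ _
      rw [hq, hA] at this
      rw [Nat.mul_div_cancel_left _ two_pos]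
      linarith
    · have := two_mul_card_add_self_eq_zero_le (exists_add_self_ne_zero_of_odd_dvd
        (A := A) hr ⟨s, rfl⟩ ⟨2 * Fintype.card V, by rw [hA]; ring⟩)
      rw [← hT, hq, hA] at this
      rw [show (2 * s + 1) / 2 = s by omega]
      have hs : 1 ≤ s := by omega
      have := Nat.mul_le_mul_left (Fintype.card V) hs
      nlinarith
  obtain ⟨a, ha, hasum⟩ := exists_le_sum_eq hqle
  obtain ⟨g, hg⟩ := hcol a hasum
  have ha' : ∀ u, 2 * a u ≤ r := fun u => by have := ha u; omega
  obtain ⟨g', hg'⟩ := exists_neg_pair_coloring (S := Tᶜ) (k := fun u => r - 2 * a u)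
    (fun x hx => by
      simp only [hT, mem_compl, mem_filter_univ] at hx ⊢
      rwa [← neg_add, neg_eq_zero])
    (fun x hx => by simpa [hT] using hx)
    (by
      have : ∑ u, (r - 2 * a u) + 2 * ∑ u, a u = r * Fintype.card V := by
        rw [mul_sum, ← sum_add_distrib, sum_congr rfl fun u _ => Nat.sub_add_cancel (ha' u)]
        simp [mul_comm]
      rw [card_compl, hq, hA, mul_assoc, ← this, hasum]
      omega)
  obtain ⟨c, hc⟩ := exists_union_coloring (disjoint_compl_right (a := T)) g g'
  refine ⟨T ∪ Tᶜ, c, fun u => ⟨?_, ?_⟩⟩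
  · rw [(hc u).1, (hg u).1, (hg' u).1]
    have := ha' u
    omega
  · rw [(hc u).2, (hg u).2, (hg' u).2, add_zero]

theorem exists_coloring_of_unique_involution {r : ℕ} (hr : 2 ≤ r)
    (hA : Fintype.card A = 2 * r * Fintype.card V) {e y : A} (he : e ≠ 0)
    (he2 : e + e = 0) (huniq : ∀ x : A, x + x = 0 → x = 0 ∨ x = e) (hy : y + y = e)
    {p q : V} (hpq : p ≠ q) :
    ∃ (S : Finset A) (g : A → V), ∀ u, #{x ∈ S | g x = u} = 2 * r ∧
      ∑ x ∈ S with g x = u, x = if u = p ∨ u = q then y else 0 := by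
  have hy0 : y ≠ 0 := by rintro rfl; exact he (by rw [← hy, add_zero])
  have hye : y ≠ e := by rintro rfl; exact hy0 (by simpa using hy)
  have hny0 : -y ≠ 0 := neg_ne_zero.2 hy0
  have hne : -e = e := (add_eq_zero_iff_neg_eq.1 he2)
  have hnye : -y ≠ e := fun h => hye (by rw [← hne, ← h, neg_neg])
  have hyny : y ≠ -y := fun h => he (by rw [← hy]; exact add_eq_zero_iff_eq_neg.2 h)
  have hey : e + -y = y := by rw [← hy, add_neg_cancel_right]
  set T : Finset A := {0, y, e, -y} with hT
  have hTcard : #T = 4 := by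
    rw [hT, card_insert_of_notMem, card_insert_of_notMem, card_pair]
    · exact hnye.symm
    · simp [hye, hyny]
    · simp [he.symm, hy0.symm, hny0.symm]
  let g : A → V := fun x => if x = 0 ∨ x = y then p else q
  have hgp : {x ∈ T | g x = p} = {0, y} := by
    ext x
    simp only [hT, g, mem_filter, mem_insert, mem_singleton]
    by_cases hx : x = 0 ∨ x = y
    · simp only [hx, if_true]; tauto
    · simp [hx, hpq.symm]
  have hgq : {x ∈ T | g x = q} = {e, -y} := by
    ext x
    simp only [hT, g, mem_filter, mem_insert, mem_singleton]
    by_cases hx : x = 0 ∨ x = y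
    · simp only [hx, if_true, hpq, and_false, false_iff]
      rcases hx with rfl | rfl <;> simp [he.symm, hny0.symm, hye, hyny]
    · simp only [hx, if_false]; tauto
  have hgo : ∀ u, u ≠ p → u ≠ q → {x ∈ T | g x = u} = ∅ := by
    intro u hup huq
    refine filter_eq_empty_iff.2 fun x _ => ?_
    simp only [g]
    split_ifs
    exacts [hup.symm, huq.symm]
  -- Classes `p` and `q` each get two elements of `T`, hence one pair fewer.
  have hk : ∀ u, (if u = p ∨ u = q then r - 1 else r) + ((if u = p then 1 else 0) +
      if u = q then 1 else 0) = r := by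
    intro u
    by_cases h1 : u = p
    · subst h1; simp [hpq]; omega
    · by_cases h2 : u = q
      · subst h2; simp [hpq.symm]; omega
      · simp [h1, h2]
  obtain ⟨g', hg'⟩ := exists_neg_pair_coloring (S := Tᶜ)
    (k := fun u => if u = p ∨ u = q then r - 1 else r)
    (fun x hx => by
      simp only [hT, mem_compl, mem_insert, mem_singleton, not_or, neg_eq_zero, neg_inj] at hx ⊢
      refine ⟨hx.1, fun h => hx.2.2.2 (by rw [← h, neg_neg]), fun h => hx.2.2.1 ?_, hx.2.1⟩
      rw [← hne, ← h, neg_neg])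
    (fun x hx h => by
      simp only [hT, mem_compl, mem_insert, mem_singleton, not_or] at hx
      rcases huniq x h with h | h <;> tauto)
    (by
      have : ∑ u, (if u = p ∨ u = q then r - 1 else r) + 2 = r * Fintype.card V := by
        have := sum_congr (rfl : (univ : Finset V) = univ) fun u _ => hk u
        rw [sum_add_distrib, sum_add_distrib] at this
        simpa [mul_comm] using this
      rw [card_compl, hTcard, hA, mul_assoc, ← this]
      omega)
  obtain ⟨c, hc⟩ := exists_union_coloring (disjoint_compl_right (a := T)) g g'
  refine ⟨T ∪ Tᶜ, c, fun u => ?_⟩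
  rw [(hc u).1, (hg' u).1, (hc u).2, (hg' u).2, add_zero]
  by_cases h1 : u = p
  · subst h1
    rw [hgp, card_pair hy0.symm, sum_pair hy0.symm]
    simp
    omega
  by_cases h2 : u = q
  · subst h2
    rw [hgq, card_pair hnye.symm, sum_pair hnye.symm, hey]
    simp
    omega
  · rw [hgo u h1 h2]
    simp [h1, h2]

end Groups

/-! ### Existence of irregular labelings -/

section Main

variable {V : Type*} [Fintype V] [Nonempty V] {H : SimpleGraph V}

theorem allGroupsIrregular_two_mul_add_one (hH : ∀ v, ¬ H.IsIsolated v) (r : ℕ) :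
    AllGroupsIrregular (lexProd H (⊥ : SimpleGraph (Fin (2 * r))))
      (2 * r * Fintype.card V + 1) := by
  classical
  refine ⟨Nat.succ_pos _, fun A _ hA => ?_⟩
  have : Finite A := Nat.finite_of_card_ne_zero (by omega)
  have := Fintype.ofFinite A
  rw [Nat.card_eq_fintype_card] at hA
  obtain ⟨S, g, hg⟩ := exists_coloring_of_odd_card (V := V) hA
  obtain ⟨w, hw, hsum⟩ := exists_injective_array fun u => (hg u).1
  obtain ⟨f, hf⟩ := mem_realizableWeights.1
    (mem_realizableWeights_of_sum_eq_zero hH fun u => (hsum u).trans (hg u).2)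
  exact ⟨f, by rwa [IsIrregularLabeling, hf]⟩

theorem allGroupsIrregular_two_mul (hH : ∀ v, ¬ H.IsIsolated v) {r : ℕ} (hr : 2 ≤ r)
    (heven : Even (r * Fintype.card V)) :
    AllGroupsIrregular (lexProd H (⊥ : SimpleGraph (Fin (2 * r)))) (2 * r * Fintype.card V) := by
  classical
  have hpos : 0 < 2 * r * Fintype.card V := by have := Fintype.card_pos (α := V); positivity
  refine ⟨hpos, fun A _ hA => ?_⟩
  have : Finite A := Nat.finite_of_card_ne_zero (by omega)
  have := Fintype.ofFinite A
  rw [Nat.card_eq_fintype_card] at hA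
  have h4 : 4 ∣ Fintype.card A := by
    obtain ⟨t, ht⟩ := heven
    exact ⟨t, by rw [hA, mul_assoc, ht]; ring⟩
  obtain ⟨e, he, he2⟩ := exists_ne_zero_add_self_eq_zero (A := A) ((by norm_num : 2 ∣ 4).trans h4)
  by_cases hex : ∃ f : A, f ≠ 0 ∧ e ≠ f ∧ f + f = 0
  · obtain ⟨f, hf, hef, hf2⟩ := hex
    obtain ⟨S, g, hg⟩ := exists_coloring_of_two_involutions (V := V) hr hA he hf hef he2 hf2
    obtain ⟨w, hw, hsum⟩ := exists_injective_array fun u => (hg u).1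
    obtain ⟨f, hf⟩ := mem_realizableWeights.1
      (mem_realizableWeights_of_sum_eq_zero hH fun u => (hsum u).trans (hg u).2)
    exact ⟨f, by rwa [IsIrregularLabeling, hf]⟩
  · have huniq : ∀ x : A, x + x = 0 → x = 0 ∨ x = e := by
      intro x hx
      by_contra! h
      exact hex ⟨x, h.1, h.2.symm, hx⟩
    obtain ⟨y, hy⟩ := exists_add_self_eq_of_unique_involution h4 he he2 huniq
    obtain ⟨p⟩ := ‹Nonempty V›
    -- The two exceptional classes must be adjacent, so that one edge labelled `y` accounts for both
    -- sums.
    obtain ⟨q, hpq⟩ : ∃ q, H.Adj p q := by simpa [SimpleGraph.IsIsolated] using hH p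
    have : Nonempty V := ⟨p⟩
    obtain ⟨S, g, hg⟩ := exists_coloring_of_unique_involution hr hA he he2 huniq hy hpq.ne
    obtain ⟨w, hw, hsum⟩ := exists_injective_array fun u => (hg u).1
    obtain ⟨f, hf⟩ := mem_realizableWeights.1
      (mem_realizableWeights_of_sum_eq_single hH (by omega) hpq y fun u =>
        (hsum u).trans (hg u).2)
    exact ⟨f, by rwa [IsIrregularLabeling, hf]⟩

end Main

end GroupIrregularity

theorem mainTheorem6 {V W : Type*} [Fintype V] [Nonempty V] [Fintype W]
    (H : SimpleGraph V) (hH : ∀ v, ¬ H.IsIsolated v)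
    (n : ℕ) (hn : Fintype.card V = n) (r : ℕ) (hr : 2 ≤ r)
    (G : SimpleGraph W)
    (hG : Nonempty (G ≃g GroupIrregularity.lexProd H (⊥ : SimpleGraph (Fin (2 * r))))) :
    GroupIrregularity.groupIrregularityStrength G =
      if Even (r * n) then 2 * r * n else 2 * r * n + 1 := by
  obtain ⟨φ⟩ := hG
  subst hn
  have hW : Fintype.card W = 2 * r * Fintype.card V := by
    rw [Fintype.card_congr φ.toEquiv, Fintype.card_prod, Fintype.card_fin, mul_comm]
  have hle : ∀ s, GroupIrregularity.AllGroupsIrregular G s → 2 * r * Fintype.card V ≤ s :=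
    fun s hs => hW ▸ hs.card_le
  split_ifs with h
  · exact le_antisymm
      (Nat.sInf_le ((GroupIrregularity.allGroupsIrregular_two_mul hH hr h).of_iso φ))
      (le_csInf ⟨_, (GroupIrregularity.allGroupsIrregular_two_mul hH hr h).of_iso φ⟩ hle)
  · have hmem := (GroupIrregularity.allGroupsIrregular_two_mul_add_one hH r).of_iso φ
    refine le_antisymm (Nat.sInf_le hmem) (le_csInf ⟨_, hmem⟩ fun s hs => ?_)
    refine Nat.succ_le_of_lt (lt_of_le_of_ne (hle s hs) ?_)
    rintro rfl
    refine GroupIrregularity.not_allGroupsIrregular_two_mul_odd (G := G) (Nat.not_even_iff_odd.1 h)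
      (hW.trans (mul_assoc _ _ _)) ?_
    rw [← mul_assoc]
    exact hs
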